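/- Let $G$ be a finite simple connected graph with at least two vertices. For $t\ge 0$, a proper edge $t$-coloring of $G$ is a map $\varphi:E(G)\to\{1,\dots,t\}$ that uses each of the $t$ colors and gives different colors to adjacent edges; $\chi'(G)$ denotes the least $t$ for which such a coloring exists, and $\alpha(G)$ the set of all proper edge $t$-colorings of $G$ with $\chi'(G)\le t\le |E(G)|$. A coloring $\varphi\in\alpha(G)$ is persistent-interval for a vertex $x$ if the set of colors of the edges incident with $x$ is a nonempty set of $d_G(x)$ consecutive integers with minimum element $1$, where $d_G(x)$ is the degree of $x$. Let $\eta_{pi}(G)$ be the maximum, over all $\varphi\in\alpha(G)$, of the number of vertices of $G$ for which $\varphi$ is persistent-interval. If $G$ is bipartite with bipartition $(X,Y)$ and $d_G(x)\le d_G(y)$ for every edge $xy$ of $G$ with $x\in X$ and $y\in Y$, then $$\eta_{pi}(G)\ge 1+|Y|.$$ The bound is sharp: for every integer $n\ge 1$, the complete bipartite graph $K_{n+1,n}$, with $X$ its part of size $n+1$ and $Y$ its part of size $n$, is connected and satisfies these hypotheses, $|Y|=n$, and $\eta_{pi}(K_{n+1,n})=1+n$. -/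

import Mathlib

namespace SimpleGraph

section EdgeColorings

variable {V : Type*} (G : SimpleGraph V)

/-- `φ : E(G) → ℕ` is a proper edge `t`-coloring of `G`: its values lie in `{1, …, t}`, each of the
`t` colors is used, and distinct edges with a common endpoint get different colors. -/
structure IsProperEdgeColoring (t : ℕ) (φ : G.EdgeLabeling ℕ) : Prop where
  mem_Icc : ∀ e, φ e ∈ Set.Icc 1 t
  used : ∀ c ∈ Set.Icc 1 t, ∃ e, φ e = c
  proper : ∀ e f : G.edgeSet, e ≠ f →
    (∃ v : V, v ∈ (e : Sym2 V) ∧ v ∈ (f : Sym2 V)) → φ e ≠ φ f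

/-- The set `α(G, t)` of all proper edge `t`-colorings of `G`. -/
def properEdgeColoringsWith (t : ℕ) : Set (G.EdgeLabeling ℕ) :=
  {φ | G.IsProperEdgeColoring t φ}

/-- The chromatic index `χ'(G)`: the least `t` for which a proper edge `t`-coloring exists. -/
noncomputable def chromaticIndex : ℕ :=
  sInf {t | (G.properEdgeColoringsWith t).Nonempty}

/-- The set `α(G)` of all proper edge colorings of `G`: the union of the sets `α(G, t)` over
`χ'(G) ≤ t ≤ |E(G)|`. -/
def properEdgeColorings : Set (G.EdgeLabeling ℕ) :=
  ⋃ t ∈ Set.Icc G.chromaticIndex G.edgeSet.ncard, G.properEdgeColoringsWith t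

variable {G}

/-- The spectrum `S_G(x, φ)`: the set of colors of the edges incident with `x`. -/
def colorSpectrum (φ : G.EdgeLabeling ℕ) (x : V) : Set ℕ :=
  {c | ∃ e : G.edgeSet, x ∈ (e : Sym2 V) ∧ φ e = c}

/-- An `h`-interval: a nonempty set `[p, q]` of consecutive integers with exactly `h` elements. -/
def IsHInterval (h : ℕ) (D : Set ℕ) : Prop :=
  (∃ p q : ℕ, p ≤ q ∧ D = Set.Icc p q) ∧ D.ncard = h

/-- `φ` is persistent-interval for `x`: the spectrum of `x` is a `d_G(x)`-interval with minimum
element `1`. -/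
def IsPersistentIntervalFor [G.LocallyFinite] (φ : G.EdgeLabeling ℕ) (x : V) : Prop :=
  IsHInterval (G.degree x) (colorSpectrum φ x) ∧ IsLeast (colorSpectrum φ x) 1

/-- `f_{G,pi}(φ)`: the number of vertices for which `φ` is persistent-interval. -/
noncomputable def persistentCount [G.LocallyFinite] (φ : G.EdgeLabeling ℕ) : ℕ :=
  {x : V | IsPersistentIntervalFor φ x}.ncard

variable (G)

/-- `η_pi(G)`: the maximum of `f_{G,pi}(φ)` over all `φ ∈ α(G)`. For finite `G` this is
a genuine maximum, see `isGreatest_etaPi`. -/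
noncomputable def etaPi [G.LocallyFinite] : ℕ :=
  sSup (persistentCount '' G.properEdgeColorings)

theorem properEdgeColorings_nonempty [Finite V] : G.properEdgeColorings.Nonempty := by
  have key : (G.properEdgeColoringsWith G.edgeSet.ncard).Nonempty := by
    let e : G.edgeSet ≃ Fin G.edgeSet.ncard := Finite.equivFin G.edgeSet
    refine ⟨fun a => (e a : ℕ) + 1, ⟨fun a => ⟨by omega, (e a).2⟩, ?_, ?_⟩⟩
    · rintro c ⟨h1, h2⟩
      refine ⟨e.symm ⟨c - 1, by omega⟩, ?_⟩
      simp only [Equiv.apply_symm_apply]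
      omega
    · intro a b hab _ h
      exact hab (e.injective (Fin.ext (by simpa using h)))
  have hmem : G.edgeSet.ncard ∈ {t | (G.properEdgeColoringsWith t).Nonempty} := key
  obtain ⟨φ, hφ⟩ := key
  exact ⟨φ, Set.mem_biUnion ⟨Nat.sInf_le hmem, le_rfl⟩ hφ⟩

theorem isGreatest_etaPi [Finite V] [G.LocallyFinite] :
    IsGreatest (persistentCount '' G.properEdgeColorings) G.etaPi := by
  have hb : BddAbove (persistentCount '' G.properEdgeColorings) := by
    refine ⟨Nat.card V, ?_⟩
    rintro _ ⟨φ, _, rfl⟩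
    exact Set.ncard_le_card _
  exact ⟨Nat.sSup_mem (G.properEdgeColorings_nonempty.image _) hb, fun _ h => le_csSup hb h⟩

/-- `(X, Y)` is a bipartition of `G`: the disjoint sets `X` and `Y` cover the vertices, and every
edge has one endpoint in each. -/
def IsBipartition (X Y : Set V) : Prop :=
  G.IsBipartiteWith X Y ∧ X ∪ Y = Set.univ

end EdgeColorings

end SimpleGraph

/-! Orient edges from X to Y and let k bound all degrees. If some matching covers every vertex of
degree k, has all its Y-ends of degree k, and meets a chosen `x₀` only if `x₀` has degree k, give it
color k and delete it. The new degrees are at most k - 1 and d(x) ≤ d(y) still holds on the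
remaining edges, so this can be repeated. A vertex of Y, and likewise `x₀`, receives a color only
when its current degree equals that color; hence its d colors are distinct, at most d, and exhaust
1, …, d.

The matching comes from two Hall injections, of the degree-k part of Y into X avoiding `x₀`, and of
the degree-k part of X into Y, glued by Mendelsohn–Dulmage. The inequality d(x) ≤ d(y) forces the
second to land in the degree-k part of Y. -/

/-! ### Matchings covering the vertices of maximum degree -/

open Finset in
/-- Hall's theorem for a family of `k`-sets in which every point has degree at most `k`; a point of
smaller degree can be avoided. -/
theorem exists_injOn_avoiding {ι α : Type*} [Fintype ι] [DecidableEq α] (t : ι → Finset α)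
    (B : Set ι) {k : ℕ} (hk : 0 < k) (ht : ∀ i ∈ B, #(t i) = k)
    (hdeg : ∀ a, #{i | a ∈ t i} ≤ k) (a₀ : α) :
    ∃ f : ι → α, Set.InjOn f B ∧ ∀ i ∈ B, f i ∈ t i ∧ (#{i | a₀ ∈ t i} < k → f i ≠ a₀) := by
  classical
  let t' : ι → Finset α := fun i => if #{i | a₀ ∈ t i} < k then (t i).erase a₀ else t i
  have hall : ∀ S : Finset ι, (S : Set ι) ⊆ B → #S ≤ #(S.biUnion t') := by
    intro S hS
    have key : ∀ U : Finset α, (∀ i ∈ S, t i ⊆ U) →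
        k * #S ≤ ∑ a ∈ U, #{i | a ∈ t i} := by
      intro U hU
      calc k * #S = ∑ i ∈ S, #(t i) := by
            rw [sum_congr rfl fun i hi => ht i (hS hi)]
            simp [mul_comm]
        _ = ∑ i ∈ S, #(U.bipartiteAbove (fun i a => a ∈ t i) i) := by
          refine sum_congr rfl fun i hi => congrArg _ ?_
          ext a
          simpa [bipartiteAbove] using @hU i hi a
        _ = ∑ a ∈ U, #(S.bipartiteBelow (fun i a => a ∈ t i) a) :=
          sum_card_bipartiteAbove_eq_sum_card_bipartiteBelow _
        _ ≤ _ := sum_le_sum fun a _ => card_le_card fun i => by simp [bipartiteBelow]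
    have bound : ∀ U : Finset α, ∑ a ∈ U, #{i | a ∈ t i} ≤ k * #U := fun U => by
      simpa [mul_comm] using sum_le_card_nsmul U _ k fun a _ => hdeg a
    by_cases h : #{i | a₀ ∈ t i} < k
    · have h0 : a₀ ∉ S.biUnion t' := by simp [t', h]
      have h1 := key (insert a₀ (S.biUnion t')) fun i hi a ha => by
        by_cases e : a = a₀
        · simp [e]
        · exact mem_insert_of_mem (mem_biUnion.2 ⟨i, hi, by simp [t', h, e, ha]⟩)
      -- The point `a₀` accounts for fewer than k incidences, so k·|S| < k·(|N| + 1) with N the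
      -- union without `a₀`; integrality restores Hall's condition.
      rw [sum_insert h0] at h1
      have h2 := bound (S.biUnion t')
      have : k * #S < k * (#(S.biUnion t') + 1) := by rw [mul_add]; omega
      exact Nat.lt_succ_iff.1 (lt_of_mul_lt_mul_left this (Nat.zero_le _))
    · have h1 := key (S.biUnion t') fun i hi a ha => mem_biUnion.2 ⟨i, hi, by simp [t', h, ha]⟩
      exact le_of_mul_le_mul_left (h1.trans (bound _)) hk
  obtain ⟨f, hf, hft⟩ :=
    (all_card_le_biUnion_card_iff_exists_injective fun i : B => t' i).1 fun S => by
      have := hall (S.map (.subtype _)) (by simp)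
      rw [card_map] at this
      convert this using 2
      ext
      simp
  refine ⟨fun i => if h : i ∈ B then f ⟨i, h⟩ else a₀, fun i hi j hj h => ?_, fun i hi => ?_⟩
  · simpa [hi, hj, hf.eq_iff] using h
  · have := hft ⟨i, hi⟩
    by_cases h : #{i | a₀ ∈ t i} < k <;> simp_all [t']

/-- Mendelsohn–Dulmage: an injection `f` of `B` into `α` and an injection `g` of `A` into `B`
combine to a matching covering `A` and `B`. -/
theorem exists_matching_of_injOn {α β : Type*} {A : Set α} {B : Set β} {f : β → α} {g : α → β}
    (hf : Set.InjOn f B) (hg : Set.InjOn g A) (hgB : Set.MapsTo g A B) :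
    ∃ m : α → β → Prop, (∀ x y, m x y → y ∈ B ∧ (x = f y ∨ x ∈ A ∧ y = g x)) ∧
      (∀ x y y', m x y → m x y' → y = y') ∧ (∀ x x' y, m x y → m x' y → x = x') ∧
      (∀ x ∈ A, ∃ y, m x y) ∧ ∀ y ∈ B, ∃ x, m x y := by
  -- As in Schröder–Bernstein, two complements make `F` monotone. At a fixed point S, the elements
  -- of S are matched by `f`, and B \ S is exactly the `g`-image of what `f '' S` leaves uncovered
  -- in A.
  let F : Set β →o Set β := ⟨fun S => B \ g '' (A \ f '' S), fun S T h =>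
    Set.sdiff_subset_sdiff_right (Set.image_mono (Set.sdiff_subset_sdiff_right (Set.image_mono h)))⟩
  obtain ⟨S, hS⟩ : ∃ S, B \ g '' (A \ f '' S) = S := ⟨F.lfp, F.map_lfp⟩
  have hSB : S ⊆ B := hS ▸ Set.sdiff_subset
  have hnot : ∀ x ∈ A, x ∉ f '' S → g x ∉ S := fun x hx hxS h => by
    rw [← hS] at h
    exact h.2 ⟨x, ⟨hx, hxS⟩, rfl⟩
  refine ⟨fun x y => (y ∈ S ∧ x = f y) ∨ (x ∈ A ∧ x ∉ f '' S ∧ y = g x), ?_, ?_, ?_, ?_, ?_⟩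
  · rintro x y (⟨hy, rfl⟩ | ⟨hx, hxS, rfl⟩)
    · exact ⟨hSB hy, .inl rfl⟩
    · exact ⟨hgB hx, .inr ⟨hx, rfl⟩⟩
  · rintro x y y' (⟨hy, rfl⟩ | ⟨hx, hxS, rfl⟩) (⟨hy', h⟩ | ⟨hx', hxS', rfl⟩)
    · exact hf (hSB hy) (hSB hy') h
    · exact (hxS' ⟨y, hy, rfl⟩).elim
    · exact (hxS ⟨y', hy', h.symm⟩).elim
    · rfl
  · rintro x x' y (⟨hy, rfl⟩ | ⟨hx, hxS, rfl⟩) (⟨hy', h⟩ | ⟨hx', hxS', h⟩)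
    · exact h.symm
    · exact (hnot x' hx' hxS' (h ▸ hy)).elim
    · exact (hnot x hx hxS hy').elim
    · exact hg hx hx' h
  · intro x hx
    by_cases h : x ∈ f '' S
    · obtain ⟨y, hy, rfl⟩ := h
      exact ⟨y, .inl ⟨hy, rfl⟩⟩
    · exact ⟨g x, .inr ⟨hx, h, rfl⟩⟩
  · intro y hy
    by_cases h : y ∈ S
    · exact ⟨f y, .inl ⟨h, rfl⟩⟩
    · rw [← hS] at h
      simp only [Set.mem_sdiff, hy, true_and, not_not] at h
      obtain ⟨x, ⟨hx, hxS⟩, rfl⟩ := h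
      exact ⟨x, .inr ⟨hx, hxS, rfl⟩⟩

open Finset in
open scoped Classical in
/-- If `d(x) ≤ d(y) ≤ k` for related `x`, `y`, some matching covers all elements of degree `k`,
uses only those `y` that have degree `k`, and avoids `x₀` if its degree is less than `k`. -/
theorem exists_matching_of_degree_le {α β : Type*} [Fintype α] [Fintype β] (r : α → β → Prop)
    (x₀ : α) (k : ℕ) (hk : 0 < k) (hX : ∀ x, #{y | r x y} ≤ k) (hY : ∀ y, #{x | r x y} ≤ k)
    (hr : ∀ x y, r x y → #{y | r x y} ≤ #{x | r x y}) :
    ∃ m : α → β → Prop, (∀ x y, m x y → r x y ∧ #{x | r x y} = k) ∧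
      (∀ x y y', m x y → m x y' → y = y') ∧ (∀ x x' y, m x y → m x' y → x = x') ∧
      (∀ x, #{y | r x y} = k → ∃ y, m x y) ∧ (∀ y, #{x | r x y} = k → ∃ x, m x y) ∧
      ∀ y, m x₀ y → #{y | r x₀ y} = k := by
  let A : Set α := {x | #{y | r x y} = k}
  let B : Set β := {y | #{x | r x y} = k}
  have hAB : ∀ x ∈ A, ∀ y, r x y → y ∈ B := fun x hx y h =>
    le_antisymm (hY y) (hx.symm.le.trans (hr x y h))
  obtain ⟨f, hf, hft⟩ := exists_injOn_avoiding (fun y => univ.filter fun x => r x y) B hk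
    (fun _ h => h) (fun x => by simpa using hX x) x₀
  simp only [mem_filter, mem_univ, true_and] at hft
  -- On this side nothing needs avoiding: `y₀` is an arbitrary argument, hence the case split.
  rcases isEmpty_or_nonempty β with hβ | ⟨⟨y₀⟩⟩
  · exact ⟨fun _ _ => False, by simp, by simp, by simp, fun x hx => by simp at hx; omega,
      fun y => isEmptyElim y, by simp⟩
  obtain ⟨g, hg, hgt⟩ := exists_injOn_avoiding (fun x => univ.filter fun y => r x y) A hk
    (fun _ h => h) (fun y => by simpa using hY y) y₀
  replace hgt : ∀ x ∈ A, r x (g x) := fun x hx => by simpa using (hgt x hx).1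
  obtain ⟨m, hm, h1, h2, h3, h4⟩ :=
    exists_matching_of_injOn hf hg fun x hx => hAB x hx _ (hgt x hx)
  refine ⟨m, fun x y h => ?_, h1, h2, h3, h4, fun y h => ?_⟩
  · obtain ⟨hy, rfl | ⟨hx, rfl⟩⟩ := hm x y h
    · exact ⟨(hft y hy).1, hy⟩
    · exact ⟨hgt x hx, hy⟩
  · obtain ⟨hy, rfl | ⟨hx, rfl⟩⟩ := hm x₀ y h
    · by_contra hne
      exact (hft y hy).2 (lt_of_le_of_ne (hX _) hne) rfl
    · exact hx

/-! ### Coloring by peeling off matchings -/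

open Finset in
open scoped Classical in
/-- A bipartite relation with `d(x) ≤ d(y)` for related `x`, `y` has a proper coloring in which
every `y`, and a prescribed `x₀`, receives colors not exceeding its degree. -/
theorem exists_coloring_le_degree {α β : Type*} [Fintype α] [Fintype β] (x₀ : α) (k : ℕ) :
    ∀ r : α → β → Prop, (∀ x, #{y | r x y} ≤ k) → (∀ y, #{x | r x y} ≤ k) →
      (∀ x y, r x y → #{y | r x y} ≤ #{x | r x y}) →
      ∃ c : α → β → ℕ, (∀ x y, r x y → 1 ≤ c x y ∧ c x y ≤ #{x | r x y}) ∧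
        (∀ y, r x₀ y → c x₀ y ≤ #{y | r x₀ y}) ∧
        (∀ x y y', r x y → r x y' → c x y = c x y' → y = y') ∧
        ∀ x x' y, r x y → r x' y → c x y = c x' y → x = x' := by
  induction k with
  | zero =>
    intro r hX _ _
    have h : ∀ x y, ¬ r x y := fun x y h => by
      have := hX x
      simp only [nonpos_iff_eq_zero, card_eq_zero, filter_eq_empty_iff] at this
      exact this (mem_univ y) h
    exact ⟨fun _ _ => 0, by simp [h]⟩
  | succ k ih =>
    intro r hX hY hr
    obtain ⟨m, hm, h1, h2, h3, h4, h5⟩ :=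
      exists_matching_of_degree_le r x₀ (k + 1) k.succ_pos hX hY hr
    obtain ⟨r', hr'⟩ : ∃ r' : α → β → Prop, ∀ x y, r' x y ↔ r x y ∧ ¬ m x y := ⟨_, fun _ _ => .rfl⟩
    have lx : ∀ x, #{y | r' x y} ≤ #{y | r x y} := fun x =>
      card_le_card fun y => by simp +contextual [hr']
    have ly : ∀ y, #{x | r' x y} ≤ #{x | r x y} := fun y =>
      card_le_card fun x => by simp +contextual [hr']
    have hX' : ∀ x, #{y | r' x y} ≤ k := fun x => by
      by_cases h : #{y | r x y} = k + 1
      · obtain ⟨y, hy⟩ := h3 x h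
        refine Nat.lt_succ_iff.1 (lt_of_lt_of_eq (card_lt_card ?_) h)
        refine ⟨fun y => by simp +contextual [hr'], fun h => ?_⟩
        have := @h y (by simp [(hm x y hy).1])
        simp [hr', hy] at this
      · have := hX x; have := lx x; omega
    have hY' : ∀ y, #{x | r' x y} ≤ k := fun y => by
      by_cases h : #{x | r x y} = k + 1
      · obtain ⟨x, hx⟩ := h4 y h
        refine Nat.lt_succ_iff.1 (lt_of_lt_of_eq (card_lt_card ?_) h)
        refine ⟨fun y => by simp +contextual [hr'], fun h => ?_⟩
        have := @h x (by simp [(hm x y hx).1])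
        simp [hr', hx] at this
      · have := hY y; have := ly y; omega
    have hdown : ∀ y, #{x | r x y} = k + 1 → k ≤ #{x | r' x y} := fun y h => by
      obtain ⟨x, hx⟩ := h4 y h
      have : (univ.filter fun x => r x y).erase x ⊆ univ.filter fun x => r' x y := by
        intro x'
        simp only [mem_erase, mem_filter, mem_univ, true_and, hr']
        exact fun ⟨hne, h⟩ => ⟨h, fun h' => hne (h2 _ _ _ h' hx)⟩
      have := card_le_card this
      rw [card_erase_of_mem (by simp [(hm x y hx).1]), h] at this
      exact this
    have hsame : ∀ y, #{x | r x y} ≠ k + 1 → #{x | r' x y} = #{x | r x y} := fun y h => by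
      congr 1
      ext x
      simp only [mem_filter, mem_univ, true_and, hr', and_iff_left_iff_imp]
      exact fun _ hx => h (hm x y hx).2
    -- The degree inequality survives: a `y` of degree k + 1 keeps degree at least k, which bounds
    -- every remaining degree, and any other `y` loses nothing.
    obtain ⟨c, c1, c2, c3, c4⟩ := ih r' hX' hY' fun x y h => by
      by_cases hy : #{x | r x y} = k + 1
      · exact (hX' x).trans (hdown y hy)
      · rw [hsame y hy]
        exact (lx x).trans (hr x y ((hr' x y).1 h).1)
    have ck : ∀ x y, r x y → ¬ m x y → c x y ≠ k + 1 := fun x y h h' => by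
      have := (c1 x y ((hr' _ _).2 ⟨h, h'⟩)).2
      have := hY' y
      omega
    refine ⟨fun x y => if m x y then k + 1 else c x y, fun x y h => ?_, fun y h => ?_,
      fun x y y' h h' => ?_, fun x x' y h h' => ?_⟩
    · by_cases hxy : m x y
      · simp [hxy, (hm x y hxy).2]
      · simpa [hxy] using ⟨(c1 x y ((hr' _ _).2 ⟨h, hxy⟩)).1, (c1 x y ((hr' _ _).2 ⟨h, hxy⟩)).2.trans (ly y)⟩
    · by_cases hxy : m x₀ y
      · simp [hxy, h5 y hxy]
      · simpa [hxy] using (c2 y ((hr' _ _).2 ⟨h, hxy⟩)).trans (lx x₀)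
    · by_cases a : m x y <;> by_cases b : m x y' <;> simp only [a, b, if_true, if_false]
      · exact fun _ => h1 _ _ _ a b
      · exact fun e => (ck x y' h' b e.symm).elim
      · exact fun e => (ck x y h a e).elim
      · exact c3 x y y' ((hr' _ _).2 ⟨h, a⟩) ((hr' _ _).2 ⟨h', b⟩)
    · by_cases a : m x y <;> by_cases b : m x' y <;> simp only [a, b, if_true, if_false]
      · exact fun _ => h2 _ _ _ a b
      · exact fun e => (ck x' y h' b e.symm).elim
      · exact fun e => (ck x y h a e).elim
      · exact c4 x x' y ((hr' _ _).2 ⟨h, a⟩) ((hr' _ _).2 ⟨h', b⟩)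

/-! ### Persistent colorings and the lower bound -/

namespace SimpleGraph

variable {V : Type*} {G : SimpleGraph V}

theorem isPersistentIntervalFor_iff [G.LocallyFinite] {φ : G.EdgeLabeling ℕ} {x : V} :
    IsPersistentIntervalFor φ x ↔ 1 ≤ G.degree x ∧ colorSpectrum φ x = Set.Icc 1 (G.degree x) := by
  constructor
  · rintro ⟨⟨⟨p, q, hpq, hD⟩, hcard⟩, hleast⟩
    rw [hD] at hcard hleast ⊢
    have hp : p = 1 := (isLeast_Icc hpq).unique hleast
    subst hp
    rw [← Finset.coe_Icc, Set.ncard_coe_finset, Nat.card_Icc, Nat.add_sub_cancel] at hcard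
    rw [← hcard]
    exact ⟨hpq, rfl⟩
  · rintro ⟨h, hD⟩
    refine ⟨⟨⟨1, _, h, hD⟩, ?_⟩, hD ▸ isLeast_Icc h⟩
    rw [hD, ← Finset.coe_Icc, Set.ncard_coe_finset, Nat.card_Icc, Nat.add_sub_cancel]

/-- If the edges at `v` have distinct colors in `{1, …, d(v)}`, all of these colors occur. -/
theorem colorSpectrum_eq_Icc [G.LocallyFinite] {φ : G.EdgeLabeling ℕ}
    (hφ : ∀ e f : G.edgeSet, e ≠ f → (∃ v : V, v ∈ (e : Sym2 V) ∧ v ∈ (f : Sym2 V)) → φ e ≠ φ f)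
    {v : V} (hv : ∀ e : G.edgeSet, v ∈ (e : Sym2 V) → φ e ∈ Set.Icc 1 (G.degree v)) :
    colorSpectrum φ v = Set.Icc 1 (G.degree v) := by
  classical
  let ψ : G.neighborSet v → ℕ := fun w => φ ⟨s(v, w), w.2⟩
  have hψ : Function.Injective ψ := by
    intro w w' h
    by_contra hne
    refine hφ ⟨s(v, w), w.2⟩ ⟨s(v, w'), w'.2⟩ (fun h => hne ?_) ⟨v, by simp, by simp⟩ h
    exact Subtype.ext (Sym2.congr_right.1 (Subtype.ext_iff.1 h))
  have himg : Finset.univ.image ψ = Finset.Icc 1 (G.degree v) := by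
    apply Finset.eq_of_subset_of_card_le
    · intro c hc
      obtain ⟨w, -, rfl⟩ := Finset.mem_image.1 hc
      exact Finset.mem_Icc.2 (hv ⟨s(v, w), w.2⟩ (by simp))
    · rw [Finset.card_image_of_injective _ hψ, Nat.card_Icc, Finset.card_univ,
        card_neighborSet_eq_degree, Nat.add_sub_cancel]
  rw [← Finset.coe_Icc, ← himg]
  ext c
  simp only [colorSpectrum, Set.mem_ofPred_eq, Finset.coe_image, Finset.coe_univ, Set.image_univ,
    Set.mem_range]
  constructor
  · rintro ⟨⟨e, he⟩, hve, rfl⟩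
    obtain ⟨w, rfl⟩ := hve
    exact ⟨⟨w, he⟩, rfl⟩
  · rintro ⟨w, rfl⟩
    exact ⟨_, by simp, rfl⟩

/-- Since every color is used, t ≤ |E(G)| is automatic. -/
theorem IsProperEdgeColoring.mem_properEdgeColorings [Finite V] {t : ℕ} {φ : G.EdgeLabeling ℕ}
    (h : G.IsProperEdgeColoring t φ) : φ ∈ G.properEdgeColorings := by
  refine Set.mem_biUnion ⟨Nat.sInf_le ⟨φ, h⟩, ?_⟩ h
  obtain ⟨ψ, hψ⟩ : ∃ ψ : G.edgeSet → ℕ, ψ = φ := ⟨_, rfl⟩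
  have hsub : (Finset.Icc 1 t : Set ℕ) ⊆ ψ '' Set.univ := fun c hc => by
    obtain ⟨e, he⟩ := h.used c (by simpa using hc)
    exact ⟨e, trivial, hψ ▸ he⟩
  have := Set.ncard_le_ncard hsub
  rw [Set.ncard_coe_finset, Nat.card_Icc, Nat.add_sub_cancel] at this
  refine this.trans ((Set.ncard_image_le Set.finite_univ).trans ?_)
  rw [Set.ncard_univ, Nat.card_coe_set_eq]

theorem one_add_ncard_le_etaPi [Fintype V] [Nontrivial V] [DecidableRel G.Adj]
    (hG : G.Connected) {X Y : Set V} (hXY : G.IsBipartition X Y)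
    (hdeg : ∀ x ∈ X, ∀ y ∈ Y, G.Adj x y → G.degree x ≤ G.degree y) :
    1 + Y.ncard ≤ G.etaPi := by
  classical
  obtain ⟨hbip, -⟩ := hXY
  have hpos : ∀ v, 1 ≤ G.degree v := fun v => hG.preconnected.degree_pos_of_nontrivial v
  obtain ⟨x₀, hx₀⟩ : X.Nonempty := by
    obtain ⟨v⟩ := hG.nonempty
    obtain ⟨w, hw⟩ := (G.degree_pos_iff_exists_adj v).1 (hpos v)
    rcases hbip.mem_of_adj hw with h | h
    exacts [⟨v, h.1⟩, ⟨w, h.2⟩]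
  obtain ⟨r, hr⟩ : ∃ r : V → V → Prop, ∀ x y, r x y ↔ x ∈ X ∧ y ∈ Y ∧ G.Adj x y :=
    ⟨_, fun _ _ => .rfl⟩
  have hasymm : ∀ x y, r x y → ¬ r y x := fun x y h h' =>
    hbip.disjoint.notMem_of_mem_left ((hr _ _).1 h).1 ((hr _ _).1 h').2.1
  have htotal : ∀ e : G.edgeSet, ∃ x y, r x y ∧ (e : Sym2 V) = s(x, y) := by
    rintro ⟨e, he⟩
    induction e using Sym2.ind with | _ a b =>
    rcases hbip.mem_of_adj he with h | h
    · exact ⟨a, b, (hr _ _).2 ⟨h.1, h.2, he⟩, rfl⟩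
    · exact ⟨b, a, (hr _ _).2 ⟨h.2, h.1, he.symm⟩, Sym2.eq_swap⟩
  have hdX : ∀ x ∈ X, (Finset.univ.filter fun y => r x y).card = G.degree x := fun x hx => by
    rw [← card_neighborFinset_eq_degree]
    congr 1
    ext y
    simp only [Finset.mem_filter, Finset.mem_univ, true_and, mem_neighborFinset, hr]
    refine ⟨fun h => h.2.2, fun h => ⟨hx, ?_, h⟩⟩
    exact hbip.mem_of_mem_adj hx h
  have hdY : ∀ y ∈ Y, (Finset.univ.filter fun x => r x y).card = G.degree y := fun y hy => by
    rw [← card_neighborFinset_eq_degree]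
    congr 1
    ext x
    simp only [Finset.mem_filter, Finset.mem_univ, true_and, mem_neighborFinset, hr]
    refine ⟨fun h => h.2.2.symm, fun h => ⟨?_, hy, h.symm⟩⟩
    exact hbip.symm.mem_of_mem_adj hy h
  have hdX' : ∀ x, (Finset.univ.filter fun y => r x y).card ≤ G.degree x := fun x => by
    rw [← card_neighborFinset_eq_degree]
    exact Finset.card_le_card fun y => by simp +contextual [hr]
  have hdY' : ∀ y, (Finset.univ.filter fun x => r x y).card ≤ G.degree y := fun y => by
    rw [← card_neighborFinset_eq_degree]
    exact Finset.card_le_card fun x => by simp +contextual [hr, G.adj_comm]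
  obtain ⟨c, hc, hc₀, hcX, hcY⟩ := exists_coloring_le_degree x₀ G.maxDegree r
    (fun x => (hdX' x).trans (G.degree_le_maxDegree x))
    (fun y => (hdY' y).trans (G.degree_le_maxDegree y)) fun x y h => by
      obtain ⟨hx, hy, h⟩ := (hr x y).1 h
      rw [hdX x hx, hdY y hy]
      exact hdeg x hx y hy h
  -- Each edge is related by `r` in exactly one direction, so the symmetric sum below has one
  -- nonzero term, its color.
  let w : V → V → ℕ := fun a b => if r a b then c a b else 0
  let φ : G.EdgeLabeling ℕ := fun e =>
    Sym2.lift ⟨fun a b => w a b + w b a, fun a b => add_comm _ _⟩ (e : Sym2 V)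
  have hφ : ∀ (e : G.edgeSet) x y, r x y → (e : Sym2 V) = s(x, y) → φ e = c x y := by
    intro e x y h he
    simp [φ, he, w, h, hasymm x y h]
  have hproper : ∀ e f : G.edgeSet, e ≠ f →
      (∃ v : V, v ∈ (e : Sym2 V) ∧ v ∈ (f : Sym2 V)) → φ e ≠ φ f := by
    rintro e f hne ⟨v, hve, hvf⟩ h
    obtain ⟨x, y, hxy, he⟩ := htotal e
    obtain ⟨x', y', hxy', hf⟩ := htotal f
    rw [hφ e x y hxy he, hφ f x' y' hxy' hf] at h
    refine hne (Subtype.ext ?_)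
    rw [he, hf]
    rw [he, Sym2.mem_iff] at hve
    rw [hf, Sym2.mem_iff] at hvf
    have hd := hbip.disjoint
    obtain ⟨hx, hy, -⟩ := (hr _ _).1 hxy
    obtain ⟨hx', hy', -⟩ := (hr _ _).1 hxy'
    rcases hve with rfl | rfl <;> rcases hvf with rfl | rfl
    · rw [hcX _ _ _ hxy hxy' h]
    · exact (hd.notMem_of_mem_left hx hy').elim
    · exact (hd.notMem_of_mem_left hx' hy).elim
    · rw [hcY _ _ _ hxy hxy' h]
  have hspecY : ∀ y ∈ Y, colorSpectrum φ y = Set.Icc 1 (G.degree y) := fun y hy =>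
    colorSpectrum_eq_Icc hproper fun e hye => by
      obtain ⟨x, y', hxy, he⟩ := htotal e
      rw [hφ e x y' hxy he]
      rw [he, Sym2.mem_iff] at hye
      rcases hye with rfl | rfl
      · exact (hbip.disjoint.notMem_of_mem_left ((hr _ _).1 hxy).1 hy).elim
      · exact hdY y hy ▸ hc x y hxy
  have hspec₀ : colorSpectrum φ x₀ = Set.Icc 1 (G.degree x₀) :=
    colorSpectrum_eq_Icc hproper fun e hxe => by
      obtain ⟨x, y, hxy, he⟩ := htotal e
      rw [hφ e x y hxy he]
      rw [he, Sym2.mem_iff] at hxe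
      rcases hxe with rfl | rfl
      · exact ⟨(hc _ y hxy).1, hdX _ hx₀ ▸ hc₀ y hxy⟩
      · exact (hbip.disjoint.notMem_of_mem_left hx₀ ((hr _ _).1 hxy).2.1).elim
  have hcol : G.IsProperEdgeColoring G.maxDegree φ := by
    refine ⟨fun e => ?_, fun i hi => ?_, hproper⟩
    · obtain ⟨x, y, hxy, he⟩ := htotal e
      rw [hφ e x y hxy he]
      exact ⟨(hc x y hxy).1, (hc x y hxy).2.trans ((hdY' y).trans (G.degree_le_maxDegree y))⟩
    -- The maximum degree is attained in Y, and the spectrum there already contains every color.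
    · obtain ⟨y, hy, hmax⟩ : ∃ y ∈ Y, G.maxDegree = G.degree y := by
        obtain ⟨v, hv⟩ := G.exists_maximal_degree_vertex
        obtain ⟨u, hu⟩ := (G.degree_pos_iff_exists_adj v).1 (hpos v)
        rcases hbip.mem_of_adj hu with h | h
        · exact ⟨u, h.2, le_antisymm (hv ▸ hdeg v h.1 u h.2 hu) (G.degree_le_maxDegree u)⟩
        · exact ⟨v, h.1, hv⟩
      rw [hmax, ← hspecY y hy] at hi
      obtain ⟨e, -, he⟩ := hi
      exact ⟨e, he⟩
  calc 1 + Y.ncard = (insert x₀ Y).ncard := by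
        rw [Set.ncard_insert_of_notMem (hbip.disjoint.notMem_of_mem_left hx₀), add_comm]
    _ ≤ persistentCount φ := by
        refine Set.ncard_le_ncard ?_ (Set.toFinite _)
        rintro v (rfl | hv)
        · exact isPersistentIntervalFor_iff.2 ⟨hpos _, hspec₀⟩
        · exact isPersistentIntervalFor_iff.2 ⟨hpos _, hspecY _ hv⟩
    _ ≤ G.etaPi := G.isGreatest_etaPi.2 ⟨φ, hcol.mem_properEdgeColorings, rfl⟩

/-! ### Sharpness for complete bipartite graphs -/

theorem isBipartition_completeBipartiteGraph (α β : Type*) :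
    (completeBipartiteGraph α β).IsBipartition (Set.range Sum.inl) (Set.range Sum.inr) := by
  refine ⟨⟨Set.isCompl_range_inl_range_inr.disjoint, ?_⟩, Set.range_inl_union_range_inr⟩
  rintro (a | a) (b | b) <;> simp

theorem degree_completeBipartiteGraph_inl {α β : Type*} [Fintype α] [Fintype β]
    [DecidableRel (completeBipartiteGraph α β).Adj] (a : α) :
    (completeBipartiteGraph α β).degree (.inl a) = Fintype.card β := by
  classical
  rw [← card_neighborFinset_eq_degree, ← Finset.card_univ, ← Finset.card_map (.inr : β ↪ α ⊕ β)]
  congr 1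
  ext (b | b) <;> simp

theorem degree_completeBipartiteGraph_inr {α β : Type*} [Fintype α] [Fintype β]
    [DecidableRel (completeBipartiteGraph α β).Adj] (b : β) :
    (completeBipartiteGraph α β).degree (.inr b) = Fintype.card α := by
  classical
  rw [← card_neighborFinset_eq_degree, ← Finset.card_univ, ← Finset.card_map (.inl : α ↪ α ⊕ β)]
  congr 1
  ext (a | a) <;> simp

/-- For `|β| < |α|`, the edges of color `|α|` at the persistent vertices of `β` lead to distinct
vertices of `α`, none of which is persistent. -/
theorem etaPi_completeBipartiteGraph_le {α β : Type*} [Fintype α] [Fintype β]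
    [DecidableRel (completeBipartiteGraph α β).Adj] (h : Fintype.card β < Fintype.card α) :
    (completeBipartiteGraph α β).etaPi ≤ Fintype.card α := by
  classical
  obtain ⟨φ, hφ, hη⟩ := (completeBipartiteGraph α β).isGreatest_etaPi.1
  rw [← hη]
  obtain ⟨t, -, -, -, hproper⟩ := Set.mem_iUnion₂.1 hφ
  have hX : ∀ a, IsPersistentIntervalFor φ (.inl a) →
      ∀ e : (completeBipartiteGraph α β).edgeSet, .inl a ∈ (e : Sym2 (α ⊕ β)) → φ e ≤ Fintype.card β := fun a ha e he => by
    have := (isPersistentIntervalFor_iff.1 ha).2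
    rw [degree_completeBipartiteGraph_inl] at this
    exact (this.subset ⟨e, he, rfl⟩).2
  have hY : ∀ b, ∃ a : α, IsPersistentIntervalFor φ (.inr b) →
      ∃ e : (completeBipartiteGraph α β).edgeSet, (e : Sym2 (α ⊕ β)) = s(.inl a, .inr b) ∧
        φ e = Fintype.card α := fun b => by
    by_cases hb : IsPersistentIntervalFor φ (.inr b)
    · have := (isPersistentIntervalFor_iff.1 hb).2
      rw [degree_completeBipartiteGraph_inr] at this
      obtain ⟨⟨e, he⟩, hbe, hc⟩ := this.superset ⟨by omega, le_rfl⟩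
      obtain ⟨a | b', rfl⟩ := hbe
      · exact ⟨a, fun _ => ⟨_, Sym2.eq_swap, hc⟩⟩
      · simp at he
    · obtain ⟨a⟩ : Nonempty α := Fintype.card_pos_iff.1 (by omega)
      exact ⟨a, fun h => (hb h).elim⟩
  choose f hf using hY
  -- Persistent vertices of α are fixed and those of β follow their edge of color |α|. No collision
  -- is possible: colors at a persistent vertex of α are at most |β| < |α|, and two edges of one
  -- color share no end.
  have hinj : Set.InjOn (Sum.elim id f) {v | IsPersistentIntervalFor φ v} := by
    have hne : ∀ a b, IsPersistentIntervalFor φ (.inl a) → IsPersistentIntervalFor φ (.inr b) →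
        a ≠ f b := by
      rintro a b ha hb rfl
      obtain ⟨e, he, hc⟩ := hf b hb
      have := hX _ ha e (by simp [he])
      omega
    rintro (a | b) hv (a' | b') hv' heq
    · exact congrArg _ heq
    · exact (hne a b' hv hv' heq).elim
    · exact (hne a' b hv' hv heq.symm).elim
    · by_contra hbb
      obtain ⟨e, he, hc⟩ := hf b hv
      obtain ⟨e', he', hc'⟩ := hf b' hv'
      replace heq : f b = f b' := heq
      refine hproper e e' (fun h => hbb ?_) ⟨.inl (f b), by simp [he], by simp [he', heq]⟩
        (hc.trans hc'.symm)
      rw [← h, he, heq] at he'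
      exact Sym2.congr_right.1 he'
  calc persistentCount φ ≤ (Set.univ : Set α).ncard :=
        Set.ncard_le_ncard_of_injOn _ (fun _ _ => Set.mem_univ _) hinj
    _ = Fintype.card α := by rw [Set.ncard_univ, Nat.card_eq_fintype_card]

theorem connected_completeBipartiteGraph (α β : Type*) [Nonempty α] [Nonempty β] :
    (completeBipartiteGraph α β).Connected := by
  obtain ⟨a⟩ := ‹Nonempty α›
  obtain ⟨b⟩ := ‹Nonempty β›
  have hb : ∀ a', (completeBipartiteGraph α β).Reachable (.inl a') (.inr b) := fun a' =>
    Adj.reachable (by simp)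
  rw [connected_iff_exists_forall_reachable]
  refine ⟨.inr b, ?_⟩
  rintro (a' | b')
  · exact (hb a').symm
  · exact (hb a).symm.trans (Adj.reachable (by simp))

end SimpleGraph

open SimpleGraph in
theorem corollary5 :
    (∀ {V : Type*} [Fintype V] [Nontrivial V] (G : SimpleGraph V) [DecidableRel G.Adj]
      (_ : G.Connected) (X Y : Set V) (_ : G.IsBipartition X Y)
      (_ : ∀ x ∈ X, ∀ y ∈ Y, G.Adj x y → G.degree x ≤ G.degree y),
      1 + Y.ncard ≤ G.etaPi) ∧
    (∀ n : ℕ, 1 ≤ n →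
      ∃ (K : SimpleGraph (Fin (n + 1) ⊕ Fin n)) (_ : DecidableRel K.Adj)
        (X Y : Set (Fin (n + 1) ⊕ Fin n)),
        K = completeBipartiteGraph (Fin (n + 1)) (Fin n) ∧
        X = Set.range Sum.inl ∧ Y = Set.range Sum.inr ∧
        K.Connected ∧ K.IsBipartition X Y ∧
        (∀ x ∈ X, ∀ y ∈ Y, K.Adj x y → K.degree x ≤ K.degree y) ∧
        Y.ncard = n ∧ K.etaPi = 1 + n) := by
  refine ⟨fun G _ hG X Y hXY hdeg => one_add_ncard_le_etaPi hG hXY hdeg, fun n hn => ?_⟩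
  classical
  have : Nonempty (Fin n) := ⟨⟨0, hn⟩⟩
  have : Nontrivial (Fin (n + 1) ⊕ Fin n) := ⟨.inl 0, .inr ⟨0, hn⟩, by simp⟩
  have hY : (Set.range (Sum.inr : Fin n → Fin (n + 1) ⊕ Fin n)).ncard = n := by
    rw [← Set.image_univ, Set.ncard_image_of_injective _ Sum.inr_injective, Set.ncard_univ,
      Nat.card_eq_fintype_card, Fintype.card_fin]
  have hK := connected_completeBipartiteGraph (Fin (n + 1)) (Fin n)
  have hbip := isBipartition_completeBipartiteGraph (Fin (n + 1)) (Fin n)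
  have hdeg : ∀ x ∈ Set.range Sum.inl, ∀ y ∈ Set.range Sum.inr,
      (completeBipartiteGraph (Fin (n + 1)) (Fin n)).Adj x y →
      (completeBipartiteGraph (Fin (n + 1)) (Fin n)).degree x ≤
        (completeBipartiteGraph (Fin (n + 1)) (Fin n)).degree y := by
    rintro _ ⟨a, rfl⟩ _ ⟨b, rfl⟩ -
    rw [degree_completeBipartiteGraph_inl, degree_completeBipartiteGraph_inr]
    simp
  refine ⟨_, inferInstance, _, _, rfl, rfl, rfl, hK, hbip, hdeg, hY, le_antisymm ?_ ?_⟩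
  · simpa [add_comm] using etaPi_completeBipartiteGraph_le (α := Fin (n + 1)) (β := Fin n) (by simp)
  · simpa only [hY] using one_add_ncard_le_etaPi hK hbip hdeg
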